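/- Equip $\mathbb{R}^3$ with the standard contact structure $\xi_{std}=\ker(dz-y\,dx)$. An (oriented) Legendrian knot is a smooth embedding of the oriented circle into $\mathbb{R}^3$ that is everywhere tangent to $\xi_{std}$. A front diagram $D$ of a Legendrian knot $K$ is the projection to the $(x,z)$-plane of a Legendrian knot Legendrian isotopic to $K$ (for instance $K$ itself) whose projection is generic: its only singularities are semicubical cusps and transverse double points, no cusp lies on another strand, and there are no triple points. At a crossing, the overcrossing strand is the one of smaller slope. A cusp is an up (down) cusp if the curve traverses it upwards (downwards). The Thurston–Bennequin number and the rotation number of $K$ are read from $D$ by $$tb(K)=w(D)-\tfrac12\,\#\{\text{cusps of }D\},\qquad rot(K)=\tfrac12\bigl(\#\{\text{down cusps of } D\}-\#\{\text{up cusps of } D\}\bigr),$$ where $w(D)$ is the writhe, the sum of the signs of the crossings. A GL-rack $(X,*,u,d)$ is a set $X$ with a binary operation $*$ such that every map $y\mapsto y*x$ is bijective and $(x*y)*z=(x*z)*(y*z)$, together with maps $u,d:X\to X$ such that $ud(x*x)=du(x*x)=x$, $u(x*y)=u(x)*y$, $d(x*y)=d(x)*y$ and $x*u(y)=x*d(y)=x*y$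 for all $x,y,z\in X$. An isomorphism of GL-racks is a bijection compatible with $*$, $u$ and $d$. The fundamental GL-rack $GLR_K$ is the GL-rack presented as follows: the generators are the arcs of $D$, that is, the pieces into which its cusps and undercrossings cut the curve; at an up (down) cusp with arriving arc $a$ and departing arc $b$ there is the relation $b=u(a)$ (respectively $b=d(a)$); at a crossing with overcrossing arc $c$, and with undercrossing arcs $a$ on the right and $b$ on the left of the oriented strand $c$, there is the relation $b=a*c$. **Theorem.** Let $K_1$ and $K_2$ be Legendrian knots in $(\mathbb{R}^3,\xi_{std})$, with $tb$, $rot$ and the fundamental GL-rack of each read from any front diagram of it. If $GLR_{K_1}$ and $GLR_{K_2}$ are isomorphic, then either $tb(K_1)=tb(K_2)$ and $rot(K_1)=rot(K_2)$, or $tb(K_1)=-tb(K_2)$ and $rot(K_1)=-rot(K_2)$. -/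

import Mathlib

open scoped ContDiff Topology

/-! ### GL-racks

Mathlib's racks act on the left: `y ◃ x` is what is often written `x * y`. -/

/-- A generalized Legendrian rack (GL-rack). With `x * y := y ◃ x` the laws read
`ud(x * x) = du(x * x) = x`, `u(x * y) = u(x) * y`, `d(x * y) = d(x) * y`,
`x * u(y) = x * d(y) = x * y`. -/
class GLRack (X : Type*) extends Rack X where
  u : X → X
  d : X → X
  u_d_act_self : ∀ x : X, u (d (act x x)) = x
  d_u_act_self : ∀ x : X, d (u (act x x)) = x
  u_act : ∀ x y : X, u (act y x) = act y (u x)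
  d_act : ∀ x y : X, d (act y x) = act y (d x)
  act_u : ∀ x y : X, act (u y) x = act y x
  act_d : ∀ x y : X, act (d y) x = act y x

/-- An isomorphism of GL-racks: a bijection compatible with the rack operation, `u` and `d`. -/
structure GLRackIso (X Y : Type*) [GLRack X] [GLRack Y] extends X ≃ Y where
  map_act' : ∀ a b : X, toFun (Shelf.act a b) = Shelf.act (toFun a) (toFun b)
  map_u' : ∀ a : X, toFun (GLRack.u a) = GLRack.u (toFun a)
  map_d' : ∀ a : X, toFun (GLRack.d a) = GLRack.d (toFun a)

/-- Words in the generators `X`: `op a b` is `a * b` and `inv a b` is `a *⁻¹ b`. -/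
inductive GLWord (X : Type*) where
  | of : X → GLWord X
  | op : GLWord X → GLWord X → GLWord X
  | inv : GLWord X → GLWord X → GLWord X
  | u : GLWord X → GLWord X
  | d : GLWord X → GLWord X

/-- The congruence on words generated by the GL-rack laws and the relations `r`. -/
inductive GLCongr {X : Type*} (r : GLWord X → GLWord X → Prop) : GLWord X → GLWord X → Prop
  | rel {a b} : r a b → GLCongr r a b
  | refl (a) : GLCongr r a a
  | symm {a b} : GLCongr r a b → GLCongr r b a
  | trans {a b c} : GLCongr r a b → GLCongr r b c → GLCongr r a c
  | op_congr {a a' b b'} : GLCongr r a a' → GLCongr r b b' → GLCongr r (.op a b) (.op a' b')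
  | inv_congr {a a' b b'} : GLCongr r a a' → GLCongr r b b' → GLCongr r (.inv a b) (.inv a' b')
  | u_congr {a a'} : GLCongr r a a' → GLCongr r (.u a) (.u a')
  | d_congr {a a'} : GLCongr r a a' → GLCongr r (.d a) (.d a')
  | inv_op (a b) : GLCongr r (.inv (.op a b) b) a
  | op_inv (a b) : GLCongr r (.op (.inv a b) b) a
  | distrib (a b c) : GLCongr r (.op (.op a b) c) (.op (.op a c) (.op b c))
  | u_d (a) : GLCongr r (.u (.d (.op a a))) a
  | d_u (a) : GLCongr r (.d (.u (.op a a))) a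
  | u_op (a b) : GLCongr r (.u (.op a b)) (.op (.u a) b)
  | d_op (a b) : GLCongr r (.d (.op a b)) (.op (.d a) b)
  | op_u (a b) : GLCongr r (.op a (.u b)) (.op a b)
  | op_d (a b) : GLCongr r (.op a (.d b)) (.op a b)

/-- The congruence `GLCongr r` as a setoid. -/
def glSetoid {X : Type*} (r : GLWord X → GLWord X → Prop) : Setoid (GLWord X) where
  r := GLCongr r
  iseqv := ⟨.refl, .symm, .trans⟩

/-- The GL-rack presented by generators `X` and relations `r`, i.e. the free GL-rack on `X`
modulo `r`. -/
def PresentedGLRack {X : Type*} (r : GLWord X → GLWord X → Prop) : Type _ :=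
  Quotient (glSetoid r)

instance PresentedGLRack.instGLRack {X : Type*} (r : GLWord X → GLWord X → Prop) :
    GLRack (PresentedGLRack r) where
  act b a := Quotient.map₂ (sa := glSetoid r) (sb := glSetoid r) (sc := glSetoid r)
    GLWord.op (fun _ _ h _ _ k => GLCongr.op_congr h k) a b
  invAct b a := Quotient.map₂ (sa := glSetoid r) (sb := glSetoid r) (sc := glSetoid r)
    GLWord.inv (fun _ _ h _ _ k => GLCongr.inv_congr h k) a b
  u := Quotient.map (sa := glSetoid r) (sb := glSetoid r) GLWord.u (fun _ _ h => GLCongr.u_congr h)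
  d := Quotient.map (sa := glSetoid r) (sb := glSetoid r) GLWord.d (fun _ _ h => GLCongr.d_congr h)
  self_distrib := by
    rintro ⟨a⟩ ⟨b⟩ ⟨c⟩
    exact Quotient.sound (s := glSetoid r) (GLCongr.distrib c b a)
  left_inv := by
    rintro ⟨a⟩ ⟨b⟩
    exact Quotient.sound (s := glSetoid r) (GLCongr.inv_op b a)
  right_inv := by
    rintro ⟨a⟩ ⟨b⟩
    exact Quotient.sound (s := glSetoid r) (GLCongr.op_inv b a)
  u_d_act_self := by
    rintro ⟨a⟩
    exact Quotient.sound (s := glSetoid r) (GLCongr.u_d a)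
  d_u_act_self := by
    rintro ⟨a⟩
    exact Quotient.sound (s := glSetoid r) (GLCongr.d_u a)
  u_act := by
    rintro ⟨a⟩ ⟨b⟩
    exact Quotient.sound (s := glSetoid r) (GLCongr.u_op a b)
  d_act := by
    rintro ⟨a⟩ ⟨b⟩
    exact Quotient.sound (s := glSetoid r) (GLCongr.d_op a b)
  act_u := by
    rintro ⟨a⟩ ⟨b⟩
    exact Quotient.sound (s := glSetoid r) (GLCongr.op_u a b)
  act_d := by
    rintro ⟨a⟩ ⟨b⟩
    exact Quotient.sound (s := glSetoid r) (GLCongr.op_d a b)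

/-! ### Legendrian knots -/

/-- An oriented Legendrian knot in `ℝ³` with the contact structure `ker (dz - y dx)`: a smooth
embedding of the circle `ℝ / ℤ`, given by its `1`-periodic coordinate functions and oriented by
its parametrization. -/
structure LegendrianKnot where
  x : ℝ → ℝ
  y : ℝ → ℝ
  z : ℝ → ℝ
  smooth_x : ContDiff ℝ ∞ x
  smooth_y : ContDiff ℝ ∞ y
  smooth_z : ContDiff ℝ ∞ z
  periodic_x : Function.Periodic x 1
  periodic_y : Function.Periodic y 1
  periodic_z : Function.Periodic z 1
  immersed : ∀ t, ¬ (deriv x t = 0 ∧ deriv y t = 0 ∧ deriv z t = 0)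
  injective : ∀ s t, x s = x t → y s = y t → z s = z t → ∃ n : ℤ, s = t + n
  legendrian : ∀ t, deriv z t = y t * deriv x t

/-- Legendrian isotopy: a smooth family of Legendrian knots joining `K` to `K'`. -/
def LegendrianIsotopic (K K' : LegendrianKnot) : Prop :=
  ∃ H : ℝ → LegendrianKnot, H 0 = K ∧ H 1 = K' ∧
    ContDiffOn ℝ ∞ (fun p : ℝ × ℝ => ((H p.1).x p.2, (H p.1).y p.2, (H p.1).z p.2))
      (Set.Icc 0 1 ×ˢ Set.univ)

namespace LegendrianKnot

variable (K : LegendrianKnot)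

/-! ### The front projection `t ↦ (x t, z t)` -/

/-- The front has a cusp at time `t`: its velocity vanishes (`z' = y x'`). -/
def IsCusp (t : ℝ) : Prop := deriv K.x t = 0

/-- The front is generic: its cusps are semicubical and lie on no other strand, and it has no
triple points. (By the Legendrian condition, strands through a double point of the front that is
not a cusp have the distinct slopes `y`, so such double points are transverse.) -/
structure HasGenericFront : Prop where
  cusp_nondegenerate : ∀ t, K.IsCusp t → deriv (deriv K.x) t ≠ 0
  cusp_not_double : ∀ s t, K.IsCusp t → K.x s = K.x t → K.z s = K.z t → ∃ n : ℤ, s = t + n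
  no_triple : ∀ r s t, K.x r = K.x s → K.z r = K.z s → K.x s = K.x t → K.z s = K.z t →
    (∃ n : ℤ, r = s + n) ∨ (∃ n : ℤ, s = t + n) ∨ (∃ n : ℤ, r = t + n)

/-- Up cusp: the curve passes upwards from the lower to the upper branch of the cusp. At a cusp,
`z(t+h) - z(t) - y(t) (x(t+h) - x(t)) = y'(t) x''(t) h³/3 + o(h³)` compares the front with its
tangent line at the cusp. -/
def IsUpCusp (t : ℝ) : Prop := K.IsCusp t ∧ 0 < deriv K.y t * deriv (deriv K.x) t

/-- Down cusp: the curve passes downwards from the upper to the lower branch of the cusp. -/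
def IsDownCusp (t : ℝ) : Prop := K.IsCusp t ∧ deriv K.y t * deriv (deriv K.x) t < 0

/-- The strands at times `t` and `s` cross in the front, the strand at `t` passing under the one
at `s`: the overcrossing strand is the one of smaller slope `y`. -/
def PassesUnder (t s : ℝ) : Prop := K.x t = K.x s ∧ K.z t = K.z s ∧ K.y s < K.y t

/-- The cross product of the front velocities of the overcrossing strand, at time `s`, and the
undercrossing strand, at time `t`. It is positive iff the undercrossing strand passes from the
right to the left of the overcrossing strand, that is, iff the crossing is positive. -/
noncomputable def velocityCross (t s : ℝ) : ℝ :=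
  deriv K.x s * deriv K.z t - deriv K.z s * deriv K.x t

/-- The crossings of the front, as pairs (undercrossing time, overcrossing time). -/
def crossings : Set (ℝ × ℝ) :=
  {p | p.1 ∈ Set.Ico (0 : ℝ) 1 ∧ p.2 ∈ Set.Ico (0 : ℝ) 1 ∧ K.PassesUnder p.1 p.2}

/-- The writhe of the front: the sum of the signs of its crossings. -/
noncomputable def writhe : ℤ :=
  ∑ᶠ p ∈ K.crossings, ((SignType.sign (K.velocityCross p.1 p.2) : SignType) : ℤ)

/-- The number of up cusps. -/
noncomputable def numUpCusps : ℕ := {t ∈ Set.Ico (0 : ℝ) 1 | K.IsUpCusp t}.ncard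

/-- The number of down cusps. -/
noncomputable def numDownCusps : ℕ := {t ∈ Set.Ico (0 : ℝ) 1 | K.IsDownCusp t}.ncard

/-- The number of cusps. -/
noncomputable def numCusps : ℕ := {t ∈ Set.Ico (0 : ℝ) 1 | K.IsCusp t}.ncard

/-! ### The fundamental GL-rack of the front -/

/-- The times at which the arcs of the front end: cusps and undercrossings. -/
def breaks : Set ℝ := {t | K.IsCusp t ∨ ∃ s, K.PassesUnder t s}

/-- Two times lie on the same arc if, modulo the period, they bound a segment of the curve
without cusps and undercrossings. -/
def SameArc (s t : {t : ℝ // t ∉ K.breaks}) : Prop :=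
  ∃ n : ℤ, Disjoint (Set.uIcc (s : ℝ) ((t : ℝ) + n)) K.breaks

/-- The arcs of the front: its pieces between consecutive cusps or undercrossings. -/
def Arc : Type := Quot K.SameArc

/-- The arc containing the point at time `t`. -/
def arc (t : {t : ℝ // t ∉ K.breaks}) : K.Arc := Quot.mk _ t

/-- `a` is the arc that arrives at time `t`. -/
def ArcBefore (t : ℝ) (a : K.Arc) : Prop :=
  ∀ᶠ s in 𝓝[<] t, ∃ h : s ∉ K.breaks, K.arc ⟨s, h⟩ = a

/-- `a` is the arc that departs at time `t`. -/
def ArcAfter (t : ℝ) (a : K.Arc) : Prop :=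
  ∀ᶠ s in 𝓝[>] t, ∃ h : s ∉ K.breaks, K.arc ⟨s, h⟩ = a

/-- The relations of the fundamental GL-rack. An up (down) cusp takes the arriving arc `a` to
`u(a)` (to `d(a)`). At a crossing with overcrossing arc `c`, the undercrossing arc on the left of
`c` is `a * c`, where `a` is the undercrossing arc on the right of `c`. -/
inductive FrontRel : GLWord K.Arc → GLWord K.Arc → Prop
  | upCusp {t : ℝ} {a b : K.Arc} : K.IsUpCusp t → K.ArcBefore t a → K.ArcAfter t b →
      FrontRel (.of b) (.u (.of a))
  | downCusp {t : ℝ} {a b : K.Arc} : K.IsDownCusp t → K.ArcBefore t a → K.ArcAfter t b →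
      FrontRel (.of b) (.d (.of a))
  | posCrossing {t s : ℝ} {a b : K.Arc} (hs : s ∉ K.breaks) : K.PassesUnder t s →
      0 < K.velocityCross t s → K.ArcBefore t a → K.ArcAfter t b →
      FrontRel (.of b) (.op (.of a) (.of (K.arc ⟨s, hs⟩)))
  | negCrossing {t s : ℝ} {a b : K.Arc} (hs : s ∉ K.breaks) : K.PassesUnder t s →
      K.velocityCross t s < 0 → K.ArcBefore t a → K.ArcAfter t b →
      FrontRel (.of a) (.op (.of b) (.of (K.arc ⟨s, hs⟩)))

/-- A front diagram of the Legendrian knot `K`: the front of a Legendrian knot that is Legendrian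
isotopic to `K` and has a generic front (for instance `K` itself, if its front is generic). -/
structure FrontDiagram where
  knot : LegendrianKnot
  isotopic : LegendrianIsotopic K knot
  generic : knot.HasGenericFront

end LegendrianKnot

namespace LegendrianKnot.FrontDiagram

variable {K : LegendrianKnot} (D : K.FrontDiagram)

/-- The Thurston-Bennequin number: the writhe minus half the number of cusps. -/
noncomputable def tb : ℚ := (D.knot.writhe : ℚ) - (D.knot.numCusps : ℚ) / 2

/-- The rotation number: half the difference of the numbers of down cusps and up cusps. -/
noncomputable def rot : ℚ := ((D.knot.numDownCusps : ℚ) - (D.knot.numUpCusps : ℚ)) / 2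

/-- The fundamental GL-rack, presented by the arcs of the front with one relation for each cusp
and each crossing. -/
abbrev GLR : Type := PresentedGLRack D.knot.FrontRel

end LegendrianKnot.FrontDiagram

/-! Call a map from a GL-rack to an abelian group a grading if `u`, `d` and the action of any
element become translations by `p`, `q` and `-(p + q)`; these translations are compatible with all
GL-rack laws. Followed along the front, a grading of the fundamental GL-rack changes by `p` at an up
cusp, by `q` at a down cusp and by `-(p + q)` times the sign of the crossing at an undercrossing.
With `U` up cusps, `D` down cusps and writhe `w`, one turn around the knot therefore forces `(U - w)
p + (D - w) q = 0`. Conversely, if this sum vanishes, the accumulated change descends to the arcs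
and extends to the presented rack. This is `exists_isGrading_iff`.

Apply this to quotients of `ℤ × ℤ`, with `p` and `q` the classes of the basis vectors: a grading in
the quotient by `H` exists iff `(U - w, D - w)` lies in `H`. The rack thus determines the cyclic
subgroup generated by this vector, hence the vector up to sign. Since `U - w = -(tb + rot)` and `D -
w = -(tb - rot)`, the pair `(tb, rot)` is determined up to a common sign.

The analytic input is that cusps and undercrossings of a generic front are isolated
(`eventually_notMem_breaks`), so that a period contains finitely many and arcs exist on both sides
of each. -/

/-! ### Gradings of GL-racks and of presented GL-racks -/

/-- A map to an abelian group on which `u` and `d` act by translation by `p` and `q`, and every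
element of the rack acts by translation by `-(p + q)`. -/
structure GLRack.IsGrading {X A : Type*} [GLRack X] [AddCommGroup A] (p q : A) (f : X → A) :
    Prop where
  map_act : ∀ x y : X, f (Shelf.act y x) = f x - (p + q)
  map_u : ∀ x : X, f (GLRack.u x) = f x + p
  map_d : ∀ x : X, f (GLRack.d x) = f x + q

theorem GLRack.IsGrading.comp_iso {X Y A : Type*} [GLRack X] [GLRack Y] [AddCommGroup A]
    {p q : A} {f : Y → A} (hf : GLRack.IsGrading p q f) (e : GLRackIso X Y) :
    GLRack.IsGrading p q (fun x => f (e.toFun x)) where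
  map_act x y := by rw [e.map_act', hf.map_act]
  map_u x := by rw [e.map_u', hf.map_u]
  map_d x := by rw [e.map_d', hf.map_d]

/-- The inverse of an isomorphism of GL-racks. -/
def GLRackIso.symm {X Y : Type*} [GLRack X] [GLRack Y] (e : GLRackIso X Y) : GLRackIso Y X where
  toEquiv := e.toEquiv.symm
  map_act' a b := by
    apply e.toEquiv.injective
    have := e.map_act' (e.toEquiv.symm a) (e.toEquiv.symm b)
    simp_all
  map_u' a := by
    apply e.toEquiv.injective
    have := e.map_u' (e.toEquiv.symm a)
    simp_all
  map_d' a := by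
    apply e.toEquiv.injective
    have := e.map_d' (e.toEquiv.symm a)
    simp_all

/-- The extension of a map on generators to words, with `u`, `d` and `*` acting by translations. -/
def GLWord.grade {X A : Type*} [AddCommGroup A] (p q : A) (f : X → A) : GLWord X → A
  | .of x => f x
  | .op a _ => a.grade p q f - (p + q)
  | .inv a _ => a.grade p q f + (p + q)
  | .u a => a.grade p q f + p
  | .d a => a.grade p q f + q

/-- The grade of a product ignores its right factor, which settles `op_u` and `op_d`; in `u_d` and
`d_u` the shifts `p`, `q` and `-(p + q)` cancel, and the remaining laws hold because translations
commute. -/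
theorem GLCongr.grade_eq {X A : Type*} [AddCommGroup A] {p q : A} {f : X → A}
    {r : GLWord X → GLWord X → Prop}
    (hr : ∀ a b, r a b → a.grade p q f = b.grade p q f) {a b : GLWord X} (h : GLCongr r a b) :
    a.grade p q f = b.grade p q f := by
  induction h with
  | rel h => exact hr _ _ h
  | refl => rfl
  | symm _ ih => exact ih.symm
  | trans _ _ ih₁ ih₂ => exact ih₁.trans ih₂
  | op_congr _ _ ih _ => simp only [GLWord.grade, ih]
  | inv_congr _ _ ih _ => simp only [GLWord.grade, ih]
  | u_congr _ ih => simp only [GLWord.grade, ih]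
  | d_congr _ ih => simp only [GLWord.grade, ih]
  | _ => simp only [GLWord.grade] <;> abel

/-- The element of the presented GL-rack represented by a word. -/
def PresentedGLRack.mk {X : Type*} (r : GLWord X → GLWord X → Prop) (a : GLWord X) :
    PresentedGLRack r :=
  Quotient.mk (glSetoid r) a

theorem PresentedGLRack.mk_eq_of_rel {X : Type*} {r : GLWord X → GLWord X → Prop}
    {a b : GLWord X} (h : r a b) : PresentedGLRack.mk r a = PresentedGLRack.mk r b :=
  Quotient.sound (s := glSetoid r) (GLCongr.rel h)

theorem PresentedGLRack.exists_isGrading {X A : Type*} [AddCommGroup A] {p q : A} {f : X → A}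
    {r : GLWord X → GLWord X → Prop}
    (hr : ∀ a b, r a b → a.grade p q f = b.grade p q f) :
    ∃ g : PresentedGLRack r → A, GLRack.IsGrading p q g := by
  refine ⟨Quotient.lift (GLWord.grade p q f) fun a b h => GLCongr.grade_eq hr h, ?_, ?_, ?_⟩
  · rintro ⟨a⟩ ⟨b⟩; rfl
  · rintro ⟨a⟩; rfl
  · rintro ⟨a⟩; rfl

/-! ### Isolatedness of the singular points of a front -/

namespace LegendrianKnot

variable (K : LegendrianKnot)

theorem hasDerivAt_x (t : ℝ) : HasDerivAt K.x (deriv K.x t) t :=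
  (K.smooth_x.differentiable (by simp) t).hasDerivAt

theorem hasDerivAt_z (t : ℝ) : HasDerivAt K.z (K.y t * deriv K.x t) t := by
  rw [← K.legendrian]
  exact (K.smooth_z.differentiable (by simp) t).hasDerivAt

theorem contDiff_deriv_x : ContDiff ℝ ∞ (deriv K.x) :=
  (contDiff_infty_iff_deriv.1 K.smooth_x).2

theorem continuous_deriv_x : Continuous (deriv K.x) := K.contDiff_deriv_x.continuous

theorem continuous_deriv_deriv_x : Continuous (deriv (deriv K.x)) :=
  (contDiff_infty_iff_deriv.1 K.contDiff_deriv_x).2.continuous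

theorem continuous_deriv_y : Continuous (deriv K.y) :=
  (contDiff_infty_iff_deriv.1 K.smooth_y).2.continuous

theorem deriv_y_ne_zero {t : ℝ} (h : K.IsCusp t) : deriv K.y t ≠ 0 := fun hy =>
  K.immersed t ⟨h, hy, by rw [K.legendrian, show deriv K.x t = 0 from h, mul_zero]⟩

theorem x_add_int (t : ℝ) (n : ℤ) : K.x (t + n) = K.x t := by
  simpa using K.periodic_x.int_mul n t

theorem y_add_int (t : ℝ) (n : ℤ) : K.y (t + n) = K.y t := by
  simpa using K.periodic_y.int_mul n t

theorem z_add_int (t : ℝ) (n : ℤ) : K.z (t + n) = K.z t := by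
  simpa using K.periodic_z.int_mul n t

/-- The Cauchy mean value theorem for the front: its chords are parallel to tangents. -/
theorem exists_chord_slope {s t : ℝ} (hst : s < t) (h : ∀ r ∈ Set.Ioo s t, deriv K.x r ≠ 0) :
    ∃ r ∈ Set.Ioo s t, K.z t - K.z s = K.y r * (K.x t - K.x s) := by
  obtain ⟨r, hr, h1⟩ := exists_ratio_hasDerivAt_eq_ratio_slope K.x (deriv K.x) hst
    K.smooth_x.continuous.continuousOn (fun r _ => K.hasDerivAt_x r) K.z
    (fun r => K.y r * deriv K.x r) K.smooth_z.continuous.continuousOn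
    (fun r _ => K.hasDerivAt_z r)
  refine ⟨r, hr, mul_right_cancel₀ (h r hr) ?_⟩
  linear_combination h1

/-- This excludes double points near a semicubical cusp, where neither `x''` nor `y'` vanishes. If
`x''` has no zero, `x` has a single critical point `c` between the two times, and the chords from
`c` to the two coinciding endpoints are parallel to tangents on either side of `c`. Equal slopes
there give a zero of `y'` by Rolle. -/
theorem exists_deriv_eq_zero_of_front_eq {s t : ℝ} (hst : s < t) (hx : K.x s = K.x t)
    (hz : K.z s = K.z t) :
    ∃ r ∈ Set.Icc s t, deriv (deriv K.x) r = 0 ∨ deriv K.y r = 0 := by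
  by_contra! H
  have hxc := K.smooth_x.continuous
  obtain ⟨c, hc, hc0⟩ := exists_deriv_eq_zero hst hxc.continuousOn hx
  have rolle {f : ℝ → ℝ} (hf : Continuous f) {a b : ℝ} (ha : s ≤ a) (hab : a < b) (hb : b ≤ t)
      (h : f a = f b) : ∃ ρ ∈ Set.Icc s t, ρ ∈ Set.Ioo a b ∧ deriv f ρ = 0 := by
    obtain ⟨ρ, hρ, h0⟩ := exists_deriv_eq_zero hab hf.continuousOn h
    exact ⟨ρ, ⟨ha.trans hρ.1.le, hρ.2.le.trans hb⟩, hρ, h0⟩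
  have hl {r : ℝ} (hr : r ∈ Set.Ioo s c) : deriv K.x r ≠ 0 := fun h => by
    obtain ⟨ρ, hρ, -, h0⟩ := rolle K.continuous_deriv_x hr.1.le hr.2 hc.2.le (h.trans hc0.symm)
    exact (H ρ hρ).1 h0
  have hr {r : ℝ} (hr : r ∈ Set.Ioo c t) : deriv K.x r ≠ 0 := fun h => by
    obtain ⟨ρ, hρ, -, h0⟩ := rolle K.continuous_deriv_x hc.1.le hr.1 hr.2.le (hc0.trans h.symm)
    exact (H ρ hρ).1 h0
  obtain ⟨α, hα, h1⟩ := K.exists_chord_slope hc.1 fun _ => hl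
  obtain ⟨β, hβ, h2⟩ := K.exists_chord_slope hc.2 fun _ => hr
  -- The two chords have opposite increments, because the front returns to its starting point.
  have h3 : (K.y α - K.y β) * (K.x c - K.x s) = 0 := by
    linear_combination -hz - h1 - h2 + K.y β * hx
  rcases mul_eq_zero.1 h3 with h3 | h3
  · obtain ⟨ρ, hρ, -, h0⟩ := rolle K.smooth_y.continuous hα.1.le (hα.2.trans hβ.1) hβ.2.le
      (sub_eq_zero.1 h3)
    exact (H ρ hρ).2 h0
  · obtain ⟨ρ, -, hρ, h0⟩ := rolle hxc le_rfl hc.1 hc.2.le (sub_eq_zero.1 h3).symm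
    exact hl hρ h0

theorem exists_deriv_x_eq_zero {s t : ℝ} (hst : s < t) (hx : K.x s = K.x t) :
    ∃ r ∈ Set.Icc s t, deriv K.x r = 0 := by
  obtain ⟨r, hr, h⟩ := exists_deriv_eq_zero hst K.smooth_x.continuous.continuousOn hx
  exact ⟨r, Set.Ioo_subset_Icc_self hr, h⟩

variable {K}

/-- The generic front is locally injective. -/
theorem HasGenericFront.eventually_front_ne (hK : K.HasGenericFront) (t₀ : ℝ) :
    ∀ᶠ p : ℝ × ℝ in 𝓝 (t₀, t₀), K.x p.1 = K.x p.2 → K.z p.1 = K.z p.2 → p.1 = p.2 := by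
  obtain ⟨V, hV, H⟩ : ∃ V ∈ 𝓝 t₀, ∀ s t, s < t → Set.Icc s t ⊆ V → K.x s = K.x t →
      K.z s ≠ K.z t := by
    by_cases h : K.IsCusp t₀
    · refine ⟨_, ((K.continuous_deriv_deriv_x.continuousAt.eventually_ne
        (hK.cusp_nondegenerate t₀ h)).and (K.continuous_deriv_y.continuousAt.eventually_ne
        (K.deriv_y_ne_zero h))), fun s t hst hV hx hz => ?_⟩
      obtain ⟨r, hr, h1⟩ := K.exists_deriv_eq_zero_of_front_eq hst hx hz
      have := hV hr
      exact h1.elim this.1 this.2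
    · refine ⟨_, K.continuous_deriv_x.continuousAt.eventually_ne h, fun s t hst hV hx _ => ?_⟩
      obtain ⟨r, hr, h1⟩ := K.exists_deriv_x_eq_zero hst hx
      exact hV hr h1
  obtain ⟨ε, hε, hb⟩ := Metric.mem_nhds_iff.1 hV
  have hconv : (Metric.ball t₀ ε).OrdConnected := (convex_ball t₀ ε).ordConnected
  have hball : Metric.ball t₀ ε ∈ 𝓝 t₀ := Metric.ball_mem_nhds t₀ hε
  filter_upwards [prod_mem_nhds hball hball] with ⟨s, t⟩ ⟨hs, ht⟩ hx hz
  rcases lt_trichotomy s t with h | h | h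
  · exact absurd hz (H s t h ((hconv.out hs ht).trans hb) hx)
  · exact h
  · exact absurd hz.symm (H t s h ((hconv.out ht hs).trans hb) hx.symm)

theorem HasGenericFront.not_isCusp_of_double (hK : K.HasGenericFront) {s t : ℝ}
    (hx : K.x s = K.x t) (hz : K.z s = K.z t) (hst : ¬ ∃ n : ℤ, s = t + n) : ¬ K.IsCusp t :=
  fun h => hst (hK.cusp_not_double s t h hx hz)

/-- Away from cusps, chords through a fixed front point have slopes tending to the tangent slope
`y`. -/
theorem exists_nhds_chord_slope {t₀ : ℝ} (h : ¬ K.IsCusp t₀) {U : Set ℝ} (hU : U ∈ 𝓝 (K.y t₀)) :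
    ∀ᶠ t in 𝓝 t₀, t ≠ t₀ → K.x t ≠ K.x t₀ ∧
      ∃ m ∈ U, K.z t - K.z t₀ = m * (K.x t - K.x t₀) := by
  obtain ⟨ε, hε, hb⟩ := Metric.mem_nhds_iff.1 (Filter.inter_mem
    (K.continuous_deriv_x.continuousAt.eventually_ne h) (K.smooth_y.continuous.continuousAt hU))
  have hconv : (Metric.ball t₀ ε).OrdConnected := (convex_ball t₀ ε).ordConnected
  filter_upwards [Metric.ball_mem_nhds t₀ hε] with t ht hne
  rcases lt_or_gt_of_ne hne with h | h
  · have hsub := (hconv.out ht (Metric.mem_ball_self hε)).trans hb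
    refine ⟨fun hx => ?_, ?_⟩
    · obtain ⟨r, hr, h1⟩ := K.exists_deriv_x_eq_zero h hx
      exact (hsub hr).1 h1
    · obtain ⟨r, hr, h1⟩ := K.exists_chord_slope h
        fun r hr => (hsub (Set.Ioo_subset_Icc_self hr)).1
      exact ⟨_, (hsub (Set.Ioo_subset_Icc_self hr)).2, by linear_combination -h1⟩
  · have hsub := (hconv.out (Metric.mem_ball_self hε) ht).trans hb
    refine ⟨fun hx => ?_, ?_⟩
    · obtain ⟨r, hr, h1⟩ := K.exists_deriv_x_eq_zero h hx.symm
      exact (hsub hr).1 h1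
    · obtain ⟨r, hr, h1⟩ := K.exists_chord_slope h
        fun r hr => (hsub (Set.Ioo_subset_Icc_self hr)).1
      exact ⟨_, (hsub (Set.Ioo_subset_Icc_self hr)).2, h1⟩

/-- If the two limit times have different front points, continuity suffices; if they are the same
point of the knot, the front is injective nearby. At a genuine double point the slopes differ, and a
second nearby crossing would give a common chord of both strands. -/
theorem HasGenericFront.eventually_not_passesUnder_nhds (hK : K.HasGenericFront) (t₀ s₀ : ℝ) :
    ∀ᶠ p : ℝ × ℝ in 𝓝 (t₀, s₀), p.1 ≠ t₀ → ¬ K.PassesUnder p.1 p.2 := by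
  have hfst : Filter.Tendsto Prod.fst (𝓝 (t₀, s₀)) (𝓝 t₀) := continuousAt_fst
  have hsnd : Filter.Tendsto Prod.snd (𝓝 (t₀, s₀)) (𝓝 s₀) := continuousAt_snd
  by_cases hx : K.x t₀ = K.x s₀
  swap
  · filter_upwards [((K.smooth_x.continuous.comp continuous_fst).continuousAt.ne_iff_eventually_ne
      (K.smooth_x.continuous.comp continuous_snd).continuousAt).1 hx] with p hp _ h
    exact hp h.1
  by_cases hz : K.z t₀ = K.z s₀
  swap
  · filter_upwards [((K.smooth_z.continuous.comp continuous_fst).continuousAt.ne_iff_eventually_ne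
      (K.smooth_z.continuous.comp continuous_snd).continuousAt).1 hz] with p hp _ h
    exact hp h.2.1
  by_cases hts : ∃ n : ℤ, t₀ = s₀ + n
  · obtain ⟨n, hn⟩ := hts
    have hshift : Filter.Tendsto (fun p : ℝ × ℝ => (p.1, p.2 + n)) (𝓝 (t₀, s₀)) (𝓝 (t₀, t₀)) := by
      have : Continuous fun p : ℝ × ℝ => (p.1, p.2 + (n : ℝ)) := by fun_prop
      simpa [← hn] using this.tendsto (t₀, s₀)
    filter_upwards [hshift.eventually (hK.eventually_front_ne t₀)] with p hp _ h
    have := hp (by rw [K.x_add_int]; exact h.1) (by rw [K.z_add_int]; exact h.2.1)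
    have hy := h.2.2
    rw [show p.1 = p.2 + n from this, K.y_add_int] at hy
    exact lt_irrefl _ hy
  · have ht : ¬ K.IsCusp t₀ := hK.not_isCusp_of_double hx.symm hz.symm
      fun ⟨n, hn⟩ => hts ⟨-n, by push_cast; linarith⟩
    have hs : ¬ K.IsCusp s₀ := hK.not_isCusp_of_double hx hz hts
    have hy : K.y t₀ ≠ K.y s₀ := fun hy => hts (K.injective _ _ hx hy hz)
    obtain ⟨U, V, hU, hV, htU, hsV, hUV⟩ := t2_separation hy
    filter_upwards [hfst.eventually (exists_nhds_chord_slope ht (hU.mem_nhds htU)),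
      hsnd.eventually (exists_nhds_chord_slope hs (hV.mem_nhds hsV))] with p h1 h2 hne h
    obtain ⟨hne1, m, hm, h3⟩ := h1 hne
    have hsne : p.2 ≠ s₀ := fun h4 => hne1 (by rw [h.1, h4, hx])
    obtain ⟨-, m', hm', h4⟩ := h2 hsne
    -- Both strands pass through the same two front points, so they share the chord.
    have : m = m' := by
      apply mul_right_cancel₀ (sub_ne_zero.2 hne1)
      linear_combination h4 - h3 + h.2.1 - hz - m' * h.1 + m' * hx
    exact Set.disjoint_left.1 hUV hm (this ▸ hm')

theorem passesUnder_add_int_left {t s : ℝ} (n : ℤ) :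
    K.PassesUnder (t + n) s ↔ K.PassesUnder t s := by
  simp only [PassesUnder, K.x_add_int, K.y_add_int, K.z_add_int]

theorem passesUnder_add_int_right {t s : ℝ} (n : ℤ) :
    K.PassesUnder t (s + n) ↔ K.PassesUnder t s := by
  simp only [PassesUnder, K.x_add_int, K.y_add_int, K.z_add_int]

theorem PassesUnder.fract {t s : ℝ} (h : K.PassesUnder t s) : K.PassesUnder t (Int.fract s) := by
  rwa [← passesUnder_add_int_right ⌊s⌋, Int.fract_add_floor]

theorem HasGenericFront.eventually_notMem_breaks (hK : K.HasGenericFront) (t₀ : ℝ) :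
    ∀ᶠ t in 𝓝[≠] t₀, t ∉ K.breaks := by
  have h1 : ∀ᶠ t in 𝓝[≠] t₀, ¬ K.IsCusp t := by
    by_cases h : K.IsCusp t₀
    · have := (K.contDiff_deriv_x.differentiable (by simp) t₀).hasDerivAt.eventually_ne
        (c := 0) (hK.cusp_nondegenerate t₀ h)
      exact this
    · exact (K.continuous_deriv_x.continuousAt.eventually_ne h).filter_mono nhdsWithin_le_nhds
  -- The overcrossing time only matters modulo the period, so compactness of `[0, 1]` makes the
  -- neighbourhood of `t₀` uniform in it.
  have h2 := (isCompact_Icc (a := (0 : ℝ)) (b := 1)).eventually_forall_of_forall_eventually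
    (P := fun t s => t ≠ t₀ → ¬ K.PassesUnder t s) (x₀ := t₀)
    fun s _ => hK.eventually_not_passesUnder_nhds t₀ s
  filter_upwards [h1, h2.filter_mono nhdsWithin_le_nhds, self_mem_nhdsWithin] with t h3 h4 h5
  rintro (h | ⟨s, h⟩)
  · exact h3 h
  · exact h4 _ ⟨Int.fract_nonneg s, (Int.fract_lt_one s).le⟩ h5 h.fract

theorem HasGenericFront.finite_breaks (hK : K.HasGenericFront) :
    (K.breaks ∩ Set.Ico 0 1).Finite := by
  by_contra h
  obtain ⟨t, -, ht⟩ := Set.Infinite.exists_accPt_of_subset_isCompact h isCompact_Icc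
    (Set.inter_subset_right.trans Set.Ico_subset_Icc_self)
  rw [accPt_iff_frequently_nhdsNE] at ht
  exact ht ((hK.eventually_notMem_breaks t).mono fun _ h h' => h h'.1)

end LegendrianKnot

/-! ### Periodicity, and the local structure at cusps and crossings -/

namespace LegendrianKnot

variable {K : LegendrianKnot}

theorem deriv_add_int_of_periodic {f : ℝ → ℝ} (hf : Function.Periodic f 1) (n : ℤ) (t : ℝ) :
    deriv f (t + n) = deriv f t := by
  rw [← deriv_comp_add_const]
  congr 1
  funext s
  simpa using hf.int_mul n s

theorem deriv_deriv_add_int_of_periodic {f : ℝ → ℝ} (hf : Function.Periodic f 1) (n : ℤ) (t : ℝ) :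
    deriv (deriv f) (t + n) = deriv (deriv f) t :=
  deriv_add_int_of_periodic (fun s => by simpa using deriv_add_int_of_periodic hf 1 s) n t

theorem isCusp_add_int {t : ℝ} (n : ℤ) : K.IsCusp (t + n) ↔ K.IsCusp t := by
  rw [IsCusp, IsCusp, deriv_add_int_of_periodic K.periodic_x]

theorem isUpCusp_add_int {t : ℝ} (n : ℤ) : K.IsUpCusp (t + n) ↔ K.IsUpCusp t := by
  rw [IsUpCusp, IsUpCusp, isCusp_add_int, deriv_add_int_of_periodic K.periodic_y,
    deriv_deriv_add_int_of_periodic K.periodic_x]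

theorem isDownCusp_add_int {t : ℝ} (n : ℤ) : K.IsDownCusp (t + n) ↔ K.IsDownCusp t := by
  rw [IsDownCusp, IsDownCusp, isCusp_add_int, deriv_add_int_of_periodic K.periodic_y,
    deriv_deriv_add_int_of_periodic K.periodic_x]

theorem add_int_mem_breaks {t : ℝ} (n : ℤ) : t + n ∈ K.breaks ↔ t ∈ K.breaks := by
  simp only [breaks, Set.mem_ofPred_eq, isCusp_add_int, passesUnder_add_int_left]

theorem velocityCross_add_int_left (t s : ℝ) (n : ℤ) :
    K.velocityCross (t + n) s = K.velocityCross t s := by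
  rw [velocityCross, velocityCross, deriv_add_int_of_periodic K.periodic_x,
    deriv_add_int_of_periodic K.periodic_z]

theorem velocityCross_add_int_right (t s : ℝ) (n : ℤ) :
    K.velocityCross t (s + n) = K.velocityCross t s := by
  rw [velocityCross, velocityCross, deriv_add_int_of_periodic K.periodic_x,
    deriv_add_int_of_periodic K.periodic_z]

theorem PassesUnder.not_congruent {t s : ℝ} (h : K.PassesUnder t s) : ¬ ∃ n : ℤ, t = s + n := by
  rintro ⟨n, rfl⟩
  exact lt_irrefl _ (K.y_add_int s n ▸ h.2.2)

theorem PassesUnder.not_congruent' {t s : ℝ} (h : K.PassesUnder t s) : ¬ ∃ n : ℤ, s = t + n := by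
  rintro ⟨n, rfl⟩
  exact lt_irrefl _ (K.y_add_int t n ▸ h.2.2)

theorem HasGenericFront.not_isCusp_under (hK : K.HasGenericFront) {t s : ℝ}
    (h : K.PassesUnder t s) : ¬ K.IsCusp t :=
  hK.not_isCusp_of_double h.1.symm h.2.1.symm h.not_congruent'

theorem HasGenericFront.not_isCusp_over (hK : K.HasGenericFront) {t s : ℝ}
    (h : K.PassesUnder t s) : ¬ K.IsCusp s :=
  hK.not_isCusp_of_double h.1 h.2.1 h.not_congruent

/-- A break on the overcrossing strand would be a cusp on a double point, a triple point, or two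
strands each passing under the other. Hence every crossing has a well-defined overcrossing arc. -/
theorem HasGenericFront.over_notMem_breaks (hK : K.HasGenericFront) {t s : ℝ}
    (h : K.PassesUnder t s) : s ∉ K.breaks := by
  rintro (hc | ⟨r, hr⟩)
  · exact hK.not_isCusp_over h hc
  · rcases hK.no_triple t s r h.1 h.2.1 hr.1 hr.2.1 with h1 | h1 | ⟨n, rfl⟩
    · exact h.not_congruent h1
    · exact hr.not_congruent h1
    · exact lt_asymm (K.y_add_int r n ▸ h.2.2) hr.2.2

theorem HasGenericFront.over_congruent (hK : K.HasGenericFront) {t s s' : ℝ}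
    (h : K.PassesUnder t s) (h' : K.PassesUnder t s') : ∃ n : ℤ, s = s' + n := by
  rcases hK.no_triple s t s' h.1.symm h.2.1.symm h'.1 h'.2.1 with h1 | h1 | h1
  · exact absurd h1 h.not_congruent'
  · exact absurd h1 h'.not_congruent
  · exact h1

theorem HasGenericFront.velocityCross_ne_zero (hK : K.HasGenericFront) {t s : ℝ}
    (h : K.PassesUnder t s) : K.velocityCross t s ≠ 0 := by
  have : K.velocityCross t s = deriv K.x s * deriv K.x t * (K.y t - K.y s) := by
    rw [velocityCross, K.legendrian, K.legendrian]; ring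
  rw [this]
  exact mul_ne_zero (mul_ne_zero (hK.not_isCusp_over h) (hK.not_isCusp_under h))
    (sub_ne_zero.2 h.2.2.ne')

theorem HasGenericFront.isUpCusp_or_isDownCusp (hK : K.HasGenericFront) {t : ℝ}
    (h : K.IsCusp t) : K.IsUpCusp t ∨ K.IsDownCusp t := by
  rcases lt_or_gt_of_ne (mul_ne_zero (K.deriv_y_ne_zero h) (hK.cusp_nondegenerate t h)) with h1 | h1
  · exact .inr ⟨h, h1⟩
  · exact .inl ⟨h, h1⟩

theorem IsUpCusp.not_isDownCusp {t : ℝ} (h : K.IsUpCusp t) : ¬ K.IsDownCusp t :=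
  fun h' => lt_asymm h.2 h'.2

/-! ### Weights of the singular points -/

variable (K) in
open Classical in
/-- The sign of the crossing at which the strand at time `t` passes under, or `0`. -/
noncomputable def underSign (t : ℝ) : ℤ :=
  if h : ∃ s, K.PassesUnder t s then SignType.sign (K.velocityCross t h.choose) else 0

theorem HasGenericFront.underSign_eq (hK : K.HasGenericFront) {t s : ℝ} (h : K.PassesUnder t s) :
    K.underSign t = SignType.sign (K.velocityCross t s) := by
  have h' : ∃ s, K.PassesUnder t s := ⟨s, h⟩
  obtain ⟨n, hn⟩ := hK.over_congruent h h'.choose_spec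
  rw [underSign, dif_pos h', hn, velocityCross_add_int_right]

theorem underSign_eq_zero {t : ℝ} (h : ¬ ∃ s, K.PassesUnder t s) : K.underSign t = 0 := by
  rw [underSign, dif_neg h]

theorem HasGenericFront.underSign_add_int (hK : K.HasGenericFront) (t : ℝ) (n : ℤ) :
    K.underSign (t + n) = K.underSign t := by
  by_cases h : ∃ s, K.PassesUnder t s
  · obtain ⟨s, h⟩ := h
    rw [hK.underSign_eq h, hK.underSign_eq ((passesUnder_add_int_left n).2 h),
      velocityCross_add_int_left]
  · rw [underSign_eq_zero h, underSign_eq_zero]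
    simpa only [passesUnder_add_int_left] using h

variable {A : Type*} [AddCommGroup A] (p q : A)

variable (K) in
open Classical in
/-- The change of a grading of the fundamental GL-rack at time `t`. -/
noncomputable def weight (t : ℝ) : A :=
  (if K.IsUpCusp t then p else 0) + (if K.IsDownCusp t then q else 0) - K.underSign t • (p + q)

theorem HasGenericFront.weight_add_int (hK : K.HasGenericFront) (t : ℝ) (n : ℤ) :
    K.weight p q (t + n) = K.weight p q t := by
  classical
  rw [weight, weight, hK.underSign_add_int, if_congr (isUpCusp_add_int n) rfl rfl,
    if_congr (isDownCusp_add_int n) rfl rfl]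

theorem weight_eq_zero {t : ℝ} (h : t ∉ K.breaks) : K.weight p q t = 0 := by
  have h1 : ¬ K.IsCusp t := fun h1 => h (.inl h1)
  have h2 : ¬ ∃ s, K.PassesUnder t s := fun h1 => h (.inr h1)
  rw [weight, if_neg fun h => h1 h.1, if_neg fun h => h1 h.1, underSign_eq_zero h2]
  simp

theorem HasGenericFront.weight_upCusp (hK : K.HasGenericFront) {t : ℝ} (h : K.IsUpCusp t) :
    K.weight p q t = p := by
  rw [weight, if_pos h, if_neg h.not_isDownCusp,
    underSign_eq_zero fun ⟨_, hs⟩ => hK.not_isCusp_under hs h.1]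
  simp

theorem HasGenericFront.weight_downCusp (hK : K.HasGenericFront) {t : ℝ} (h : K.IsDownCusp t) :
    K.weight p q t = q := by
  rw [weight, if_neg fun h' => h'.not_isDownCusp h, if_pos h,
    underSign_eq_zero fun ⟨_, hs⟩ => hK.not_isCusp_under hs h.1]
  simp

theorem HasGenericFront.weight_posCrossing (hK : K.HasGenericFront) {t s : ℝ}
    (h : K.PassesUnder t s) (h0 : 0 < K.velocityCross t s) : K.weight p q t = -(p + q) := by
  have h1 := hK.not_isCusp_under h
  rw [weight, if_neg fun h => h1 h.1, if_neg fun h => h1 h.1, hK.underSign_eq h, sign_pos h0]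
  simp

theorem HasGenericFront.weight_negCrossing (hK : K.HasGenericFront) {t s : ℝ}
    (h : K.PassesUnder t s) (h0 : K.velocityCross t s < 0) : K.weight p q t = p + q := by
  have h1 := hK.not_isCusp_under h
  rw [weight, if_neg fun h => h1 h.1, if_neg fun h => h1 h.1, hK.underSign_eq h, sign_neg h0]
  simp [add_comm]

/-- The breaks in a period. -/
noncomputable def HasGenericFront.breakTimes (hK : K.HasGenericFront) : Finset ℝ :=
  hK.finite_breaks.toFinset

theorem HasGenericFront.mem_breakTimes (hK : K.HasGenericFront) {t : ℝ} :
    t ∈ hK.breakTimes ↔ t ∈ K.breaks ∧ t ∈ Set.Ico (0 : ℝ) 1 := by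
  simp [breakTimes]

/-- Without triple points a crossing is determined by its undercrossing time, so the writhe can be
summed over breaks; cusps contribute zero. -/
theorem HasGenericFront.sum_underSign (hK : K.HasGenericFront) :
    ∑ t ∈ hK.breakTimes, K.underSign t = K.writhe := by
  classical
  have hinj : Set.InjOn Prod.fst K.crossings := by
    rintro ⟨t, s⟩ ⟨-, hs, h⟩ ⟨t', s'⟩ ⟨-, hs', h'⟩ (rfl : t = t')
    obtain ⟨n, hn⟩ := hK.over_congruent h h'
    simp only at hs hs' hn
    rw [← Int.fract_eq_self.2 hs, ← Int.fract_eq_self.2 hs', hn, Int.fract_add_intCast]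
  have h1 : K.writhe = ∑ᶠ t ∈ Prod.fst '' K.crossings, K.underSign t := by
    rw [finsum_mem_image hinj]
    exact finsum_mem_congr rfl fun p hp => (hK.underSign_eq hp.2.2).symm
  rw [h1]
  refine (finsum_mem_eq_sum_of_inter_support_eq _ ?_).symm
  ext t
  simp only [Set.mem_inter_iff, Function.mem_support, Finset.mem_coe, hK.mem_breakTimes]
  refine and_congr_left fun h0 => ⟨?_, fun h => ?_⟩
  · rintro ⟨p, hp, rfl⟩
    exact ⟨.inr ⟨_, hp.2.2⟩, hp.1⟩
  · obtain ⟨s, hs⟩ := not_imp_comm.1 underSign_eq_zero h0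
    exact ⟨(t, Int.fract s), ⟨h.2, ⟨Int.fract_nonneg s, Int.fract_lt_one s⟩, hs.fract⟩, rfl⟩

open Classical in
theorem HasGenericFront.sum_cusps (hK : K.HasGenericFront) {P : ℝ → Prop}
    (hP : ∀ t, P t → K.IsCusp t) (a : A) :
    ∑ t ∈ hK.breakTimes, (if P t then a else 0) = {t ∈ Set.Ico (0 : ℝ) 1 | P t}.ncard • a := by
  rw [← Finset.sum_filter, Finset.sum_const, ← Set.ncard_coe_finset]
  congr 2
  ext t
  simp only [Finset.coe_filter, hK.mem_breakTimes, Set.mem_ofPred_eq]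
  exact ⟨fun h => ⟨h.1.2, h.2⟩, fun h => ⟨⟨.inl (hP t h.2), h.1⟩, h.2⟩⟩

theorem HasGenericFront.sum_weight (hK : K.HasGenericFront) :
    ∑ t ∈ hK.breakTimes, K.weight p q t =
      ((K.numUpCusps : ℤ) - K.writhe) • p + ((K.numDownCusps : ℤ) - K.writhe) • q := by
  simp only [weight]
  rw [Finset.sum_sub_distrib, Finset.sum_add_distrib, ← Finset.sum_smul, hK.sum_underSign,
    hK.sum_cusps fun _ h => h.1, hK.sum_cusps fun _ h => h.1, numUpCusps, numDownCusps]
  simp only [sub_smul, smul_add, natCast_zsmul]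
  abel

theorem HasGenericFront.numCusps_eq (hK : K.HasGenericFront) :
    K.numCusps = K.numUpCusps + K.numDownCusps := by
  have hfin {P : ℝ → Prop} (hP : ∀ t, P t → K.IsCusp t) :
      {t ∈ Set.Ico (0 : ℝ) 1 | P t}.Finite :=
    hK.finite_breaks.subset fun t ht => ⟨.inl (hP t ht.2), ht.1⟩
  rw [numUpCusps, numDownCusps, ← Set.ncard_union_eq _ (hfin fun _ h => h.1) (hfin fun _ h => h.1)]
  · rw [numCusps]
    congr 1
    ext t
    constructor
    · rintro ⟨h, hc⟩
      exact (hK.isUpCusp_or_isDownCusp hc).imp (⟨h, ·⟩) (⟨h, ·⟩)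
    · rintro (h | h)
      · exact ⟨h.1, h.2.1⟩
      · exact ⟨h.1, h.2.1⟩
  · exact Set.disjoint_left.2 fun t h h' => h.2.not_isDownCusp h'.2

/-! ### The height function: a step function jumping by the weights -/

/-- The accumulated weight of the breaks up to time `t`. -/
noncomputable def HasGenericFront.height (hK : K.HasGenericFront) (t : ℝ) : A :=
  ∑ b ∈ hK.breakTimes, ⌈t - b⌉ • K.weight p q b

theorem HasGenericFront.height_add_int (hK : K.HasGenericFront) (t : ℝ) (n : ℤ) :
    hK.height p q (t + n) = hK.height p q t + n • ∑ b ∈ hK.breakTimes, K.weight p q b := by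
  rw [height, height, Finset.smul_sum, ← Finset.sum_add_distrib]
  refine Finset.sum_congr rfl fun b _ => ?_
  rw [← add_smul, add_sub_right_comm, Int.ceil_add_intCast]

theorem HasGenericFront.height_eq_of_le (hK : K.HasGenericFront) {s t : ℝ} (hst : s ≤ t)
    (h : Disjoint (Set.Ico s t) K.breaks) : hK.height p q s = hK.height p q t := by
  refine Finset.sum_congr rfl fun b hb => ?_
  congr 1
  refine le_antisymm (Int.ceil_mono (by linarith)) (not_lt.1 fun hlt => ?_)
  have h1 := Int.le_ceil (s - b)
  have h2 := Int.lt_ceil.1 hlt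
  -- If the ceiling increases, a translate of the break `b` lies in `[s, t)`.
  have h3 : b + (⌈s - b⌉ : ℝ) ∈ Set.Ico s t := ⟨by linarith, by linarith⟩
  exact Set.disjoint_left.1 h h3 ((add_int_mem_breaks _).2 (hK.mem_breakTimes.1 hb).1)

/-- The coefficient `⌊r⌋ + 1 - ⌈r⌉` is `1` for integral `r` and `0` otherwise, so it selects the
break congruent to `t`. -/
theorem HasGenericFront.sum_congruent_weight (hK : K.HasGenericFront) (t : ℝ) :
    ∑ b ∈ hK.breakTimes, (⌊t - b⌋ + 1 - ⌈t - b⌉) • K.weight p q b = K.weight p q t := by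
  have hfr : K.weight p q (Int.fract t) = K.weight p q t := by
    rw [← hK.weight_add_int p q (Int.fract t) ⌊t⌋, Int.fract_add_floor]
  rw [← hfr]
  trans (⌊t - Int.fract t⌋ + 1 - ⌈t - Int.fract t⌉) • K.weight p q (Int.fract t)
  · refine Finset.sum_eq_single _ (fun b hb hne => ?_) fun hb => ?_
    · have : ⌈t - b⌉ = ⌊t - b⌋ + 1 := by
        refine (Int.ceil_eq_floor_add_one_iff_notMem _).2 ?_
        rintro ⟨n, hn⟩
        refine hne ?_
        rw [← Int.fract_eq_self.2 (hK.mem_breakTimes.1 hb).2, show t = b + n by linarith,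
          Int.fract_add_intCast]
      rw [this, sub_self, zero_smul]
    · rw [weight_eq_zero, smul_zero]
      exact fun h => hb (hK.mem_breakTimes.2 ⟨h, Int.fract_nonneg t, Int.fract_lt_one t⟩)
  · simp [Int.self_sub_fract]

/-- Just to the right of `t` each ceiling equals `⌊t - b⌋ + 1`, so the jump is the sum computed in
`sum_congruent_weight`. The ceiling makes the height left-continuous, so the whole jump occurs on
this side. -/
theorem HasGenericFront.eventually_height_right (hK : K.HasGenericFront) (t : ℝ) :
    ∀ᶠ s in 𝓝[>] t, hK.height p q s = hK.height p q t + K.weight p q t := by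
  have h (b : ℝ) : ∀ᶠ s in 𝓝[>] t, ⌈s - b⌉ = ⌊t - b⌋ + 1 := by
    have h1 : t < b + ⌊t - b⌋ + 1 := by linarith [Int.lt_floor_add_one (t - b)]
    filter_upwards [Ioo_mem_nhdsGT h1] with s hs
    rw [Int.ceil_eq_iff]
    push_cast
    constructor <;> linarith [Int.floor_le (t - b), hs.1, hs.2]
  filter_upwards [(Filter.eventually_all_finset hK.breakTimes).2 fun b _ => h b] with s hs
  rw [← hK.sum_congruent_weight p q t, height, height, ← Finset.sum_add_distrib]
  refine Finset.sum_congr rfl fun b hb => ?_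
  rw [hs b hb, ← add_smul]
  congr 1
  ring

theorem HasGenericFront.eventually_height_left (hK : K.HasGenericFront) (t : ℝ) :
    ∀ᶠ s in 𝓝[<] t, hK.height p q s = hK.height p q t := by
  obtain ⟨l, hl, h⟩ := mem_nhdsLT_iff_exists_Ioo_subset.1
    ((hK.eventually_notMem_breaks t).filter_mono (nhdsLT_le_nhdsNE t))
  filter_upwards [Ioo_mem_nhdsLT hl] with s hs
  exact hK.height_eq_of_le p q hs.2.le
    (Set.disjoint_left.2 fun r hr => h ⟨hs.1.trans_le hr.1, hr.2⟩)

end LegendrianKnot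

/-! ### Gradings of the fundamental GL-rack -/

namespace LegendrianKnot

variable {K : LegendrianKnot} {A : Type*} [AddCommGroup A] {p q : A}

theorem arc_eq_of_disjoint {s t : {t : ℝ // t ∉ K.breaks}}
    (h : Disjoint (Set.uIcc (s : ℝ) t) K.breaks) : K.arc s = K.arc t :=
  Quot.sound ⟨0, by simpa using h⟩

theorem arc_add_int (t : ℝ) (n : ℤ) (h : t ∉ K.breaks) (h' : t + n ∉ K.breaks) :
    K.arc ⟨t + n, h'⟩ = K.arc ⟨t, h⟩ :=
  Quot.sound ⟨n, by simpa using h'⟩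

theorem HasGenericFront.exists_arcBefore (hK : K.HasGenericFront) (t : ℝ) :
    ∃ a, K.ArcBefore t a := by
  obtain ⟨l, hl, h⟩ := mem_nhdsLT_iff_exists_Ioo_subset.1
    ((hK.eventually_notMem_breaks t).filter_mono (nhdsLT_le_nhdsNE t))
  obtain ⟨m, hm⟩ := exists_between (show l < t from hl)
  refine ⟨K.arc ⟨m, h hm⟩, ?_⟩
  filter_upwards [Ioo_mem_nhdsLT hl] with s hs
  exact ⟨h hs, arc_eq_of_disjoint (Set.disjoint_left.2 fun r hr =>
    h (Set.ordConnected_Ioo.uIcc_subset hs hm hr))⟩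

theorem HasGenericFront.exists_arcAfter (hK : K.HasGenericFront) (t : ℝ) :
    ∃ a, K.ArcAfter t a := by
  obtain ⟨l, hl, h⟩ := mem_nhdsGT_iff_exists_Ioo_subset.1
    ((hK.eventually_notMem_breaks t).filter_mono (nhdsGT_le_nhdsNE t))
  obtain ⟨m, hm⟩ := exists_between (show t < l from hl)
  refine ⟨K.arc ⟨m, h hm⟩, ?_⟩
  filter_upwards [Ioo_mem_nhdsGT hl] with s hs
  exact ⟨h hs, arc_eq_of_disjoint (Set.disjoint_left.2 fun r hr =>
    h (Set.ordConnected_Ioo.uIcc_subset hs hm hr))⟩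

theorem HasGenericFront.eventually_arc_eq (hK : K.HasGenericFront) {t : ℝ} (ht : t ∉ K.breaks) :
    ∀ᶠ s in 𝓝 t, ∃ h : s ∉ K.breaks, K.arc ⟨s, h⟩ = K.arc ⟨t, ht⟩ := by
  have h1 : {s | s ∉ K.breaks} ∈ 𝓝 t := by
    have := hK.eventually_notMem_breaks t
    rw [eventually_nhdsWithin_iff] at this
    filter_upwards [this] with s hs
    by_cases h : s = t
    · exact h ▸ ht
    · exact hs h
  obtain ⟨ε, hε, hb⟩ := Metric.mem_nhds_iff.1 h1
  have hconv : (Metric.ball t ε).OrdConnected := (convex_ball t ε).ordConnected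
  filter_upwards [Metric.ball_mem_nhds t hε] with s hs
  exact ⟨hb hs, arc_eq_of_disjoint (Set.disjoint_left.2 fun r hr =>
    hb (hconv.uIcc_subset hs (Metric.mem_ball_self hε) hr))⟩

theorem ArcBefore.unique {t : ℝ} {a b : K.Arc} (ha : K.ArcBefore t a) (hb : K.ArcBefore t b) :
    a = b := by
  obtain ⟨s, ⟨h, rfl⟩, h', rfl⟩ := (ha.and hb).exists
  rfl

theorem ArcAfter.unique {t : ℝ} {a b : K.Arc} (ha : K.ArcAfter t a) (hb : K.ArcAfter t b) :
    a = b := by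
  obtain ⟨s, ⟨h, rfl⟩, h', rfl⟩ := (ha.and hb).exists
  rfl

variable (p q) in
/-- A map on arcs that changes by the weight at every time. -/
def IsArcGrading (f : K.Arc → A) : Prop :=
  ∀ t a b, K.ArcBefore t a → K.ArcAfter t b → f b = f a + K.weight p q t

/-- Vanishing total weight makes the height periodic; being constant between breaks, it descends to
arcs. -/
theorem HasGenericFront.exists_isArcGrading (hK : K.HasGenericFront)
    (h0 : ∑ t ∈ hK.breakTimes, K.weight p q t = 0) :
    ∃ f : K.Arc → A, IsArcGrading p q f := by
  have hper (t : ℝ) (n : ℤ) : hK.height p q (t + n) = hK.height p q t := by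
    rw [hK.height_add_int, h0, smul_zero, add_zero]
  have hresp (s t : {t : ℝ // t ∉ K.breaks}) (h : K.SameArc s t) :
      hK.height p q s = hK.height p q t := by
    obtain ⟨n, hn⟩ := h
    rw [← hper t n]
    rcases le_total (s : ℝ) (t + n) with h | h
    · rw [Set.uIcc_of_le h] at hn
      exact hK.height_eq_of_le p q h (hn.mono_left Set.Ico_subset_Icc_self)
    · rw [Set.uIcc_of_ge h] at hn
      exact (hK.height_eq_of_le p q h (hn.mono_left Set.Ico_subset_Icc_self)).symm
  refine ⟨Quot.lift (fun t => hK.height p q t) hresp, fun t a b ha hb => ?_⟩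
  obtain ⟨s, ⟨hs, rfl⟩, h1⟩ := (ha.and (hK.eventually_height_left p q t)).exists
  obtain ⟨r, ⟨hr, rfl⟩, h2⟩ := (hb.and (hK.eventually_height_right p q t)).exists
  change hK.height p q r = hK.height p q s + _
  rw [h1, h2]

/-- An arc grading and the height have the same jumps, so their difference is constant on the line.
Over one period the grading returns to its value while the height grows by the total weight. -/
theorem HasGenericFront.sum_weight_eq_zero (hK : K.HasGenericFront) {f : K.Arc → A}
    (hf : IsArcGrading p q f) : ∑ t ∈ hK.breakTimes, K.weight p q t = 0 := by
  -- Using the arriving arc defines the grading at break times too, with the same left-continuity as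
  -- the height.
  choose before hbefore using hK.exists_arcBefore
  have harc {t : ℝ} (ht : t ∉ K.breaks) : before t = K.arc ⟨t, ht⟩ :=
    (hbefore t).unique ((hK.eventually_arc_eq ht).filter_mono nhdsWithin_le_nhds)
  let g : ℝ → A := fun t => f (before t) - hK.height p q t
  have hg : IsLocallyConstant g := by
    rw [IsLocallyConstant.iff_eventually_eq]
    intro t
    rw [← nhdsNE_sup_pure t, ← nhdsLT_sup_nhdsGT, Filter.eventually_sup, Filter.eventually_sup]
    refine ⟨⟨?_, ?_⟩, Filter.eventually_pure.2 rfl⟩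
    · filter_upwards [hbefore t, hK.eventually_height_left p q t] with s ⟨hs, h1⟩ h2
      simp only [g, h2, harc hs, h1]
    · obtain ⟨b, hb⟩ := hK.exists_arcAfter t
      filter_upwards [hb, hK.eventually_height_right p q t] with s ⟨hs, h1⟩ h2
      simp only [g, h2, harc hs, h1, hf t _ b (hbefore t) hb]
      abel
  obtain ⟨t, ht⟩ := (hK.eventually_notMem_breaks 0).exists
  have ht' : t + (1 : ℤ) ∉ K.breaks := (add_int_mem_breaks 1).not.2 ht
  have := hg.apply_eq_of_preconnectedSpace (t + (1 : ℤ)) t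
  simp only [g] at this
  rw [harc ht', harc ht, arc_add_int t 1 ht ht', hK.height_add_int, one_smul] at this
  simpa using this

theorem HasGenericFront.isArcGrading_of_isGrading (hK : K.HasGenericFront)
    {f : PresentedGLRack K.FrontRel → A} (hf : GLRack.IsGrading p q f) :
    IsArcGrading p q fun a : K.Arc => f (.mk _ (.of a)) := by
  intro t a b ha hb
  beta_reduce
  by_cases ht : t ∈ K.breaks
  · rcases ht with hc | ⟨s, hs⟩
    · rcases hK.isUpCusp_or_isDownCusp hc with h | h
      · rw [hK.weight_upCusp p q h, PresentedGLRack.mk_eq_of_rel (.upCusp h ha hb)]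
        exact hf.map_u (.mk _ (.of a))
      · rw [hK.weight_downCusp p q h, PresentedGLRack.mk_eq_of_rel (.downCusp h ha hb)]
        exact hf.map_d (.mk _ (.of a))
    · have hsb := hK.over_notMem_breaks hs
      rcases lt_or_gt_of_ne (hK.velocityCross_ne_zero hs) with h | h
      -- At a negative crossing the arriving arc is the product, so the relation is read backwards.
      · rw [hK.weight_negCrossing p q hs h, ← sub_eq_iff_eq_add,
          PresentedGLRack.mk_eq_of_rel (a := .of a) (.negCrossing hsb hs h ha hb)]
        exact (hf.map_act (.mk _ (.of b)) (.mk _ (.of (K.arc ⟨s, hsb⟩)))).symm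
      · rw [hK.weight_posCrossing p q hs h, ← sub_eq_add_neg,
          PresentedGLRack.mk_eq_of_rel (.posCrossing hsb hs h ha hb)]
        exact hf.map_act (.mk _ (.of a)) (.mk _ (.of (K.arc ⟨s, hsb⟩)))
  · have h := hK.eventually_arc_eq ht
    have h1 : a = K.arc ⟨t, ht⟩ := ha.unique (h.filter_mono nhdsWithin_le_nhds)
    have h2 : b = K.arc ⟨t, ht⟩ := hb.unique (h.filter_mono nhdsWithin_le_nhds)
    rw [weight_eq_zero p q ht, h1, h2, add_zero]

theorem HasGenericFront.grade_eq_of_frontRel (hK : K.HasGenericFront) {f : K.Arc → A}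
    (hf : IsArcGrading p q f) (a b : GLWord K.Arc) (h : K.FrontRel a b) :
    a.grade p q f = b.grade p q f := by
  cases h with
  | upCusp h ha hb => simp only [GLWord.grade, hf _ _ _ ha hb, hK.weight_upCusp p q h]
  | downCusp h ha hb => simp only [GLWord.grade, hf _ _ _ ha hb, hK.weight_downCusp p q h]
  | posCrossing _ hs h ha hb =>
    simp only [GLWord.grade, hf _ _ _ ha hb, hK.weight_posCrossing p q hs h, sub_eq_add_neg]
  | negCrossing _ hs h ha hb =>
    simp only [GLWord.grade, hf _ _ _ ha hb, hK.weight_negCrossing p q hs h, add_sub_cancel_right]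

/-- The fundamental GL-rack has a grading in which `u` and `d` act by translation by `p` and `q`
iff the total weight of the front vanishes. -/
theorem HasGenericFront.exists_isGrading_iff (hK : K.HasGenericFront) :
    (∃ f : PresentedGLRack K.FrontRel → A, GLRack.IsGrading p q f) ↔
      ((K.numUpCusps : ℤ) - K.writhe) • p + ((K.numDownCusps : ℤ) - K.writhe) • q = 0 := by
  rw [← hK.sum_weight]
  constructor
  · rintro ⟨f, hf⟩
    exact hK.sum_weight_eq_zero (hK.isArcGrading_of_isGrading hf)
  · intro h
    obtain ⟨f, hf⟩ := hK.exists_isArcGrading h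
    exact PresentedGLRack.exists_isGrading (hK.grade_eq_of_frontRel hf)

/-! ### The cyclic subgroup determined by the GL-rack, and the conclusion -/

variable (K) in
/-- The generator of the relations between the translations by `u` and `d` in gradings of the
fundamental GL-rack. -/
noncomputable def totalWeight : ℤ × ℤ :=
  ((K.numUpCusps : ℤ) - K.writhe, (K.numDownCusps : ℤ) - K.writhe)

theorem HasGenericFront.exists_isGrading_quotient_iff (hK : K.HasGenericFront)
    (H : AddSubgroup (ℤ × ℤ)) :
    (∃ f : PresentedGLRack K.FrontRel → (ℤ × ℤ) ⧸ H,
      GLRack.IsGrading (QuotientAddGroup.mk (1, 0)) (QuotientAddGroup.mk (0, 1)) f) ↔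
      K.totalWeight ∈ H := by
  rw [hK.exists_isGrading_iff, ← QuotientAddGroup.eq_zero_iff, ← QuotientAddGroup.mk_zsmul,
    ← QuotientAddGroup.mk_zsmul, ← QuotientAddGroup.mk_add]
  simp [totalWeight]

/-- The second rack has a grading modulo its own total weight; pulled back along `e`, it forces the
first total weight to vanish in the same quotient. -/
theorem totalWeight_mem_zmultiples {K₁ K₂ : LegendrianKnot} (h₁ : K₁.HasGenericFront)
    (h₂ : K₂.HasGenericFront)
    (e : GLRackIso (PresentedGLRack K₁.FrontRel) (PresentedGLRack K₂.FrontRel)) :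
    K₁.totalWeight ∈ AddSubgroup.zmultiples K₂.totalWeight := by
  obtain ⟨f, hf⟩ := (h₂.exists_isGrading_quotient_iff _).2
    (AddSubgroup.mem_zmultiples K₂.totalWeight)
  exact (h₁.exists_isGrading_quotient_iff _).1 ⟨_, hf.comp_iso e⟩

end LegendrianKnot

theorem LegendrianKnot.FrontDiagram.totalWeight_eq {K : LegendrianKnot} (D : K.FrontDiagram) :
    (D.knot.totalWeight.1 : ℚ) = -(D.tb + D.rot) ∧
      (D.knot.totalWeight.2 : ℚ) = -(D.tb - D.rot) := by
  have h : (D.knot.numCusps : ℚ) = D.knot.numUpCusps + D.knot.numDownCusps := by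
    exact_mod_cast D.generic.numCusps_eq
  simp only [totalWeight, tb, rot, h]
  push_cast
  constructor <;> ring

/-- For nonzero `w`, torsion-freeness makes the two multipliers mutually inverse integers, hence
both `1` or both `-1`. -/
theorem eq_or_eq_neg_of_mem_zmultiples {G : Type*} [AddCommGroup G] [IsAddTorsionFree G] {v w : G}
    (h : v ∈ AddSubgroup.zmultiples w) (h' : w ∈ AddSubgroup.zmultiples v) : v = w ∨ v = -w := by
  obtain ⟨m, rfl⟩ := AddSubgroup.mem_zmultiples_iff.1 h
  obtain ⟨n, hn⟩ := AddSubgroup.mem_zmultiples_iff.1 h'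
  rw [smul_smul] at hn
  by_cases hw : w = 0
  · simp [hw]
  have h1 : n * m = 1 := by
    have : (n * m - 1) • w = 0 := by rw [sub_smul, hn, one_smul, sub_self]
    exact sub_eq_zero.1 ((smul_eq_zero.1 this).resolve_right hw)
  rcases Int.isUnit_iff.1 (IsUnit.of_mul_eq_one n (by rwa [mul_comm])) with rfl | rfl
  · simp
  · simp

theorem theorem1 (K₁ K₂ : LegendrianKnot) (D₁ : K₁.FrontDiagram) (D₂ : K₂.FrontDiagram)
    (h : Nonempty (GLRackIso D₁.GLR D₂.GLR)) :
    (D₁.tb = D₂.tb ∧ D₁.rot = D₂.rot) ∨ (D₁.tb = -D₂.tb ∧ D₁.rot = -D₂.rot) := by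
  obtain ⟨e⟩ := h
  obtain ⟨h₁, h₁'⟩ := D₁.totalWeight_eq
  obtain ⟨h₂, h₂'⟩ := D₂.totalWeight_eq
  refine (eq_or_eq_neg_of_mem_zmultiples
    (LegendrianKnot.totalWeight_mem_zmultiples D₁.generic D₂.generic e)
    (LegendrianKnot.totalWeight_mem_zmultiples D₂.generic D₁.generic e.symm)).imp ?_ ?_
  · intro h
    rw [h] at h₁ h₁'
    constructor <;> linarith
  · intro h
    rw [h, Prod.fst_neg, Int.cast_neg] at h₁
    rw [h, Prod.snd_neg, Int.cast_neg] at h₁'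
    constructor <;> linarith
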